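/- Probabilistic zero forcing on a finite simple graph $G$ is the following random process. Initially the vertices of a set $S$ are blue and all others are white. At each time step, every blue vertex $u$ forces each of its white neighbors $v$ to become blue, independently over all such pairs $(u,v)$, with probability $C[u]/\deg u$, where $C[u]$ is the number of currently blue vertices in the closed neighborhood of $u$ (including $u$ itself); blue vertices stay blue. The propagation time of $S$ is the number of time steps until all vertices are blue, $\operatorname{ept}(G,S)$ is its expected value, and $\operatorname{ept}(G)=\min_{v\in V(G)}\operatorname{ept}(G,\{v\})$. Theorem. The expected propagation time of the $n$-dimensional hypercube graph $Q_n$ on $2^n$ vertices is $O(n\log n)$: there is an absolute constant $C>0$ such that $\operatorname{ept}(Q_n)\le C\,n\log n$ for all $n\ge 2$. -/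

import Mathlib

open MeasureTheory
open scoped ENNReal

noncomputable section

namespace ProbZeroForcing

/-- The `n`-dimensional hypercube graph: its `2 ^ n` vertices are the binary words of length `n`,
two of them being adjacent when they differ in exactly one coordinate. -/
def hypercube (n : ℕ) : SimpleGraph (Fin n → Bool) where
  Adj x y := hammingDist x y = 1
  symm := ⟨fun x y h => by rw [hammingDist_comm]; exact h⟩
  loopless := ⟨fun x h => by simp at h⟩

instance (n : ℕ) : DecidableRel (hypercube n).Adj :=
  fun x y => inferInstanceAs (Decidable (hammingDist x y = 1))

variable {V : Type*} [Fintype V] [DecidableEq V]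

/-- `C[u]`: the number of blue vertices in the closed neighborhood of `u`, where `B` is the set of
blue vertices. -/
def closedBlueCount (G : SimpleGraph V) [DecidableRel G.Adj] (B : Finset V) (u : V) : ℕ :=
  (B.filter fun w => w = u ∨ G.Adj u w).card

/-- The probability `C[u] / deg u` with which a blue vertex `u` forces a given white neighbor.
(It is only used for a blue `u` that has a white neighbor; it then lies in `(0, 1]`.) -/
def forceProb (G : SimpleGraph V) [DecidableRel G.Adj] (B : Finset V) (u : V) : ℝ :=
  (closedBlueCount G B u : ℝ) / (G.degree u : ℝ)

/-- One time step from the blue set `B`, driven by numbers `x (u, v) ∈ [0, 1]`, one for every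
ordered pair of vertices: blue vertices stay blue, and the blue vertex `u` forces its white
neighbor `v` exactly when `x (u, v) ≤ C[u] / deg u`. -/
def step (G : SimpleGraph V) [DecidableRel G.Adj] (B : Finset V) (x : V × V → unitInterval) :
    Finset V :=
  open Classical in
  B ∪ Finset.univ.filter fun v => ∃ u ∈ B, G.Adj u v ∧ (x (u, v) : ℝ) ≤ forceProb G B u

/-- The sample space: a number in `[0, 1]` for every time step and every ordered pair of
vertices. -/
abbrev Sample (V : Type*) : Type _ := ℕ → V × V → unitInterval

/-- The law of independent uniform random variables on `[0, 1]`, one for every time step and every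
ordered pair of vertices. With it, given the current blue set `B`, each blue `u` forces each white
neighbor `v` with probability `C[u] / deg u`, independently over all such pairs `(u, v)`. -/
def sampleMeasure (V : Type*) [Fintype V] : Measure (Sample V) :=
  Measure.infinitePi fun _ : ℕ =>
    Measure.pi fun _ : V × V => (volume : Measure unitInterval)

/-- The set of blue vertices after `t` time steps, starting from the blue set `S`. -/
def blue (G : SimpleGraph V) [DecidableRel G.Adj] (S : Finset V) (ω : Sample V) : ℕ → Finset V
  | 0 => S
  | t + 1 => step G (blue G S ω t) (ω t)

/-- The propagation time of `S`: the number of time steps until all vertices are blue, `⊤` if this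
never happens. -/
def propTime (G : SimpleGraph V) [DecidableRel G.Adj] (S : Finset V) (ω : Sample V) : ℕ∞ :=
  ⨅ (t : ℕ) (_ : blue G S ω t = Finset.univ), (t : ℕ∞)

/-- The expected propagation time `ept(G, S)` of the initial blue set `S`. -/
def eptFrom (G : SimpleGraph V) [DecidableRel G.Adj] (S : Finset V) : ℝ≥0∞ :=
  ∫⁻ ω, (propTime G S ω : ℝ≥0∞) ∂(sampleMeasure V)

/-- The expected propagation time `ept(G)`: the least expected propagation time of a single initial
blue vertex. -/
def ept (G : SimpleGraph V) [DecidableRel G.Adj] : ℝ≥0∞ :=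
  ⨅ v : V, eptFrom G {v}

end ProbZeroForcing

end

noncomputable section

namespace ProbZeroForcing

variable {V : Type*} [Fintype V] [DecidableEq V]

open ProbabilityTheory

/-! Around a blue vertex `u`, consider the ratio of white neighbors to blue vertices in its closed
neighborhood. The forces of `u` alone add a binomial number of blue neighbors, and a second-moment
estimate shows that the expected ratio drops by a factor `3/4` per step
(`transition_whiteRatio_le`). The ratio is at most `d = deg u` initially and at least `1/d` while
some neighbor is white, so by Markov's inequality a given neighbor is still white after `t` steps
with probability at most `n² (3/4)^t` (`iterate_transition_notMem_le`). Hence `s = O(log n)` steps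
make it blue with probability at least `1/2`.

Now fix a target `v` and give the blue set the potential `4^d`, with `d` its distance to `v` (and
`0` once `v` is blue). In a block of `s` steps a nearest blue vertex turns a neighbor one step
closer to `v` blue with probability at least `1/2`, so the expected potential shrinks by `3/4`
(`iterate_transition_distPotential_le`). Summed over the `2^n` targets the potential starts at no
more than `8^n`, so a union bound makes the failure probability geometrically small after `8n`
blocks, giving expected time at most `s (8n + 4)`. -/

/-- The expected value of `f` at the blue set reached in one step from `B`. -/
def transition (G : SimpleGraph V) [DecidableRel G.Adj] (f : Finset V → ℝ≥0∞) (B : Finset V) :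
    ℝ≥0∞ :=
  ∫⁻ x, f (step G B x) ∂(Measure.pi fun _ : V × V => (volume : Measure unitInterval))

instance : IsProbabilityMeasure (sampleMeasure V) := by
  unfold sampleMeasure; infer_instance

/-! ### The blue set as a Markov chain -/

section

variable (G : SimpleGraph V) [DecidableRel G.Adj]

lemma subset_step (B : Finset V) (x : V × V → unitInterval) : B ⊆ step G B x :=
  Finset.subset_union_left

lemma measurable_step (B : Finset V) : Measurable (step G B) := by
  classical
  rw [measurable_finset_iff]
  intro v
  simp only [step, Finset.mem_union, Finset.mem_filter, Finset.mem_univ, true_and]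
  refine measurable_const.or (Measurable.exists fun u => ?_)
  refine measurable_const.and (measurable_const.and ?_)
  exact measurableSet_setOfPred.1 (measurableSet_le (by fun_prop) measurable_const)

lemma measurable_step_uncurry :
    Measurable fun p : Finset V × (V × V → unitInterval) => step G p.1 p.2 :=
  measurable_from_prod_countable_right fun B => measurable_step G B

lemma measurable_blue (S : Finset V) (t : ℕ) : Measurable fun ω : Sample V => blue G S ω t := by
  induction t with
  | zero => exact measurable_const
  | succ t ih =>
    have ht : Measurable fun ω : Sample V => ω t := measurable_pi_apply t
    have h := (measurable_step_uncurry G).comp (ih.prodMk ht)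
    simp only [Function.comp_def] at h
    simpa only [blue] using h

lemma blue_congr (S : Finset V) {ω ω' : Sample V} {t : ℕ} (h : ∀ i < t, ω i = ω' i) :
    blue G S ω t = blue G S ω' t := by
  induction t with
  | zero => rfl
  | succ t ih => rw [blue, blue, ih fun i hi => h i (by omega), h t (by omega)]

/-- The blue set at time `t` reads only the samples before `t`. Extending those by an arbitrary
value (here `0`) factors it through a finite subfamily disjoint from `{t}`. -/
lemma indepFun_blue (S : Finset V) (t : ℕ) :
    IndepFun (fun ω : Sample V => blue G S ω t) (fun ω => ω t) (sampleMeasure V) := by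
  have h : iIndepFun (fun (i : ℕ) (ω : Sample V) => ω i) (sampleMeasure V) :=
    iIndepFun_infinitePi
      (P := fun _ : ℕ => Measure.pi fun _ : V × V => (volume : Measure unitInterval))
      (X := fun _ x => x) fun _ => measurable_id
  have h2 := h.indepFun_finset (Finset.range t) {t} (by simp) (fun i => measurable_pi_apply i)
  let ext : (Finset.range t → V × V → unitInterval) → Sample V :=
    fun y i => if hi : i ∈ Finset.range t then y ⟨i, hi⟩ else 0
  have hext : Measurable ext := by
    refine measurable_pi_lambda _ fun i => ?_
    by_cases hi : i ∈ Finset.range t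
    · simpa only [ext, hi, dif_pos] using measurable_pi_apply _
    · simpa only [ext, hi, dif_neg, not_false_eq_true] using measurable_const
  have h3 := h2.comp ((measurable_blue G S t).comp hext)
    (measurable_pi_apply (X := fun _ : ({t} : Finset ℕ) => V × V → unitInterval) ⟨t, by simp⟩)
  have heq : (fun ω : Sample V => blue G S ω t) = ((fun ω => blue G S ω t) ∘ ext) ∘
      fun (ω : Sample V) (i : Finset.range t) => ω i := by
    ext1 ω
    refine blue_congr G S fun i hi => ?_
    simp [ext, hi]
  rw [heq]
  exact h3

lemma lintegral_blue_succ (S : Finset V) (t : ℕ) (f : Finset V → ℝ≥0∞) :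
    ∫⁻ ω, f (blue G S ω (t + 1)) ∂(sampleMeasure V) =
      ∫⁻ ω, transition G f (blue G S ω t) ∂(sampleMeasure V) := by
  have hf : Measurable f := measurable_of_countable f
  have hb := measurable_blue G S t
  have ht : Measurable fun ω : Sample V => ω t := measurable_pi_apply t
  have hs : Measurable fun p : Finset V × (V × V → unitInterval) => f (step G p.1 p.2) :=
    hf.comp (measurable_step_uncurry G)
  have hmap := (indepFun_iff_map_prod_eq_prod_map_map hb.aemeasurable ht.aemeasurable).1
    (indepFun_blue G S t)
  have heval : (sampleMeasure V).map (fun ω => ω t) =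
      Measure.pi fun _ : V × V => (volume : Measure unitInterval) :=
    Measure.infinitePi_map_eval _ t
  calc ∫⁻ ω, f (blue G S ω (t + 1)) ∂(sampleMeasure V)
      = ∫⁻ p, f (step G p.1 p.2) ∂((sampleMeasure V).map fun ω => (blue G S ω t, ω t)) :=
        (lintegral_map hs (hb.prodMk ht)).symm
    _ = ∫⁻ B, transition G f B ∂((sampleMeasure V).map fun ω => blue G S ω t) := by
        rw [hmap, heval, lintegral_prod _ hs.aemeasurable]; rfl
    _ = _ := lintegral_map (measurable_of_countable _) hb

lemma lintegral_blue (S : Finset V) (t : ℕ) (f : Finset V → ℝ≥0∞) :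
    ∫⁻ ω, f (blue G S ω t) ∂(sampleMeasure V) = (transition G)^[t] f S := by
  induction t generalizing f with
  | zero => simp [blue]
  | succ t ih => rw [lintegral_blue_succ, ih, Function.iterate_succ_apply]

lemma measurable_comp_step (f : Finset V → ℝ≥0∞) (B : Finset V) :
    Measurable fun x => f (step G B x) :=
  (measurable_of_countable f).comp (measurable_step G B)

variable {G}

lemma transition_mono {f g : Finset V → ℝ≥0∞} {B : Finset V} (h : ∀ B', B ⊆ B' → f B' ≤ g B') :
    transition G f B ≤ transition G g B :=
  lintegral_mono fun x => h _ (subset_step G B x)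

lemma transition_const_mul (c : ℝ≥0∞) (f : Finset V → ℝ≥0∞) :
    transition G (fun B => c * f B) = fun B => c * transition G f B :=
  funext fun B => lintegral_const_mul c (measurable_comp_step G f B)

/-- Blue sets only grow, so a comparison on supersets of `B` suffices; this is what lets later
arguments assume that a given blue vertex stays blue. -/
lemma iterate_transition_mono {f g : Finset V → ℝ≥0∞} (t : ℕ) {B : Finset V}
    (h : ∀ B', B ⊆ B' → f B' ≤ g B') : (transition G)^[t] f B ≤ (transition G)^[t] g B := by
  induction t generalizing f g B with
  | zero => exact h B subset_rfl
  | succ t ih =>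
    simp only [Function.iterate_succ_apply]
    exact ih fun B' hB => transition_mono fun B'' hB' => h B'' (hB.trans hB')

lemma iterate_transition_const_mul (t : ℕ) (c : ℝ≥0∞) (f : Finset V → ℝ≥0∞) (B : Finset V) :
    (transition G)^[t] (fun B => c * f B) B = c * (transition G)^[t] f B := by
  induction t generalizing f with
  | zero => rfl
  | succ t ih => rw [Function.iterate_succ_apply, transition_const_mul, ih]; rfl

lemma iterate_transition_add (t : ℕ) (f g : Finset V → ℝ≥0∞) (B : Finset V) :
    (transition G)^[t] (fun B => f B + g B) B =
      (transition G)^[t] f B + (transition G)^[t] g B := by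
  simp only [← lintegral_blue]
  exact lintegral_add_left ((measurable_of_countable f).comp (measurable_blue G B t)) _

lemma iterate_transition_sum {ι : Type*} (s : Finset ι) (t : ℕ) (f : ι → Finset V → ℝ≥0∞)
    (B : Finset V) :
    (transition G)^[t] (fun B => ∑ i ∈ s, f i B) B = ∑ i ∈ s, (transition G)^[t] (f i) B := by
  simp only [← lintegral_blue]
  exact lintegral_finsetSum s fun i _ =>
    (measurable_of_countable (f i)).comp (measurable_blue G B t)

lemma iterate_transition_const (t : ℕ) (c : ℝ≥0∞) (B : Finset V) :
    (transition G)^[t] (fun _ => c) B = c := by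
  simp [← lintegral_blue]

lemma iterate_transition_le_pow {f : Finset V → ℝ≥0∞} {c : ℝ≥0∞} {s : ℕ} {B : Finset V}
    (h : ∀ B', B ⊆ B' → (transition G)^[s] f B' ≤ c * f B') (m : ℕ) :
    (transition G)^[s * m] f B ≤ c ^ m * f B := by
  induction m with
  | zero => simp
  | succ m ih =>
    rw [Nat.mul_succ, Function.iterate_add_apply]
    calc (transition G)^[s * m] ((transition G)^[s] f) B
        ≤ (transition G)^[s * m] (fun B => c * f B) B := iterate_transition_mono _ h
      _ = c * (transition G)^[s * m] f B := iterate_transition_const_mul _ _ _ _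
      _ ≤ c * (c ^ m * f B) := by gcongr
      _ = c ^ (m + 1) * f B := by ring

end

/-! ### Contraction inequalities for the white-to-blue ratio -/

/-- The number of white neighbors of `u` divided by the number of blue vertices in its closed
neighborhood, written as a function of the latter. -/
def whiteRatio (d k : ℕ) : ℝ := ((d : ℝ) + 1) / k - 1

lemma whiteRatio_nonneg {d k : ℕ} (hk : 0 < k) (hkd : k ≤ d + 1) : 0 ≤ whiteRatio d k := by
  have hk' : (0 : ℝ) < k := by exact_mod_cast hk
  have : (k : ℝ) ≤ d + 1 := by exact_mod_cast hkd
  rw [whiteRatio, sub_nonneg, le_div_iff₀ hk']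
  linarith

lemma whiteRatio_anti {d k k' : ℕ} (hk : 0 < k) (hkk : k ≤ k') :
    whiteRatio d k' ≤ whiteRatio d k := by
  unfold whiteRatio
  gcongr

/-- A quadratic majorant of `1 / (1 + s)`, so that two moments of `X` suffice: after clearing the
denominator, the gap is `s (s - 1)² / 4` with `s = X / k`. -/
lemma whiteRatio_add_le (d k X : ℕ) (hk : 0 < k) :
    whiteRatio d (k + X) ≤
      ((d : ℝ) + 1) / k * (1 - (3 * (X / k) - X ^ 2 / k ^ 2) / 4) - 1 := by
  have hk' : (0 : ℝ) < k := by exact_mod_cast hk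
  have hs : (0 : ℝ) ≤ X / k := by positivity
  have key : 1 / (1 + (X : ℝ) / k) ≤ 1 - (3 * (X / k) - (X / k) ^ 2) / 4 := by
    rw [div_le_iff₀ (by positivity)]
    nlinarith [mul_nonneg hs (sq_nonneg ((X : ℝ) / k - 1))]
  have e : ((d : ℝ) + 1) / ((k + X : ℕ) : ℝ) = (d + 1) / k * (1 / (1 + X / k)) := by
    push_cast
    field_simp
  unfold whiteRatio
  rw [e, ← div_pow]
  gcongr

/-- If the number of new blue vertices among `w` white ones has the first two moments of a binomial
variable, the bound of `whiteRatio_add_le` contracts `whiteRatio` in expectation. -/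
lemma expected_whiteRatio_le {d k w : ℕ} {m₁ m₂ : ℝ} (hk : 0 < k) (hwk : w + k = d + 1)
    (h₁ : m₁ = w * (k / d)) (h₂ : m₂ ≤ w ^ 2 * (k / d) ^ 2 + w * ((k : ℝ) / d)) :
    ((d : ℝ) + 1) / k * (1 - (3 * (m₁ / k) - m₂ / k ^ 2) / 4) - 1 ≤ 3 / 4 * whiteRatio d k := by
  have hk' : (1 : ℝ) ≤ k := by exact_mod_cast hk
  have hwk' : (w : ℝ) + k = d + 1 := by exact_mod_cast hwk
  -- For `d = 0` the quotient `k / d` is `0` by convention, and `w = 0`, `k = 1`.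
  rcases Nat.eq_zero_or_pos d with rfl | hd
  · have hw0 : w = 0 := by omega
    subst hw0
    simp at h₁ h₂ hwk'
    subst h₁
    unfold whiteRatio
    simp [hwk']
    linarith
  have hd' : (0 : ℝ) < d := by exact_mod_cast hd
  set m : ℝ := w / d with hm
  have hm0 : 0 ≤ m := by positivity
  have hm1 : m ≤ 1 := by rw [hm, div_le_one hd']; linarith
  have e1 : m₁ / k = m := by rw [h₁, hm]; field_simp
  have e2 : m₂ / k ^ 2 ≤ m ^ 2 + m := by
    have : m₂ / k ^ 2 ≤ m ^ 2 + m / k := by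
      rw [div_le_iff₀ (by positivity)]
      refine h₂.trans (le_of_eq ?_)
      rw [hm]; field_simp
    have : m / k ≤ m := div_le_self hm0 hk'
    linarith
  -- The right side is at least `2m - m²`, and `m ≤ 1`.
  have e3 : m ≤ 3 * (m₁ / k) - m₂ / k ^ 2 := by rw [e1]; nlinarith
  have e4 : (w : ℝ) / k ≤ (d + 1) / k * m := by
    rw [hm, div_mul_div_comm, div_le_div_iff₀ (by positivity) (by positivity)]
    nlinarith [mul_nonneg (Nat.cast_nonneg (α := ℝ) w) (Nat.cast_nonneg (α := ℝ) k)]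
  have e5 : (w : ℝ) / k = (d + 1) / k - 1 := by
    rw [eq_sub_iff_add_eq, ← hwk']; field_simp
  have e6 : ((d : ℝ) + 1) / k * (1 - (3 * (m₁ / k) - m₂ / k ^ 2) / 4)
      ≤ (d + 1) / k * (1 - m / 4) := by gcongr
  unfold whiteRatio
  nlinarith

/-! ### Moments of a sum of independent indicators -/

section Moments

variable {ι : Type*}

/-- The indicator that the coordinate `i` is at most `q`. -/
def hit (q : ℝ) (i : ι) (x : ι → unitInterval) : ℝ := if (x i : ℝ) ≤ q then 1 else 0

lemma measurable_ite_le (q : ℝ) :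
    Measurable fun y : unitInterval => if (y : ℝ) ≤ q then (1 : ℝ) else 0 :=
  Measurable.ite (measurableSet_le (by fun_prop) measurable_const) measurable_const
    measurable_const

lemma measurable_hit (q : ℝ) (i : ι) : Measurable (hit q i) :=
  (measurable_ite_le q).comp (measurable_pi_apply i)

lemma norm_hit_le_one (q : ℝ) (i : ι) (x : ι → unitInterval) : ‖hit q i x‖ ≤ 1 := by
  unfold hit; split_ifs <;> simp

lemma hit_mul_self (q : ℝ) (i : ι) (x : ι → unitInterval) :
    hit q i x * hit q i x = hit q i x := by
  unfold hit; split_ifs <;> simp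

variable [Fintype ι]

local notation "𝐏" => Measure.pi fun _ : ι => (volume : Measure unitInterval)

lemma integrable_hit (q : ℝ) (i : ι) : Integrable (hit q i) 𝐏 :=
  Integrable.of_bound (measurable_hit q i).aestronglyMeasurable 1 (ae_of_all _ (norm_hit_le_one q i))

lemma integrable_hit_mul_hit (q : ℝ) (i j : ι) :
    Integrable (fun x => hit q i x * hit q j x) 𝐏 :=
  Integrable.of_bound ((measurable_hit q i).mul (measurable_hit q j)).aestronglyMeasurable 1
    (ae_of_all _ fun x => by
      rw [norm_mul]
      exact mul_le_one₀ (norm_hit_le_one q i x) (norm_nonneg _) (norm_hit_le_one q j x))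

lemma integral_hit {q : ℝ} (h0 : 0 ≤ q) (h1 : q ≤ 1) (i : ι) : ∫ x, hit q i x ∂𝐏 = q := by
  have h := (measurePreserving_eval (fun _ : ι => (volume : Measure unitInterval)) i)
  have e := integral_map (μ := 𝐏) h.measurable.aemeasurable
    (measurable_ite_le q).aestronglyMeasurable
  rw [h.map_eq] at e
  change ∫ x, hit q i x ∂𝐏 = q
  refine e.symm.trans ?_
  have : (fun y : unitInterval => if (y : ℝ) ≤ q then (1 : ℝ) else 0) =
      (Set.Iic (⟨q, h0, h1⟩ : unitInterval)).indicator 1 := by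
    ext y
    simp only [Set.indicator_apply, Set.mem_Iic, ← Subtype.coe_le_coe, Pi.one_apply]
  rw [this, integral_indicator_one measurableSet_Iic, measureReal_def, unitInterval.volume_Iic,
    ENNReal.toReal_ofReal h0]

lemma integral_hit_mul_hit {q : ℝ} (h0 : 0 ≤ q) (h1 : q ≤ 1) {i j : ι} (hij : i ≠ j) :
    ∫ x, hit q i x * hit q j x ∂𝐏 = q ^ 2 := by
  have h : iIndepFun (fun (i : ι) => hit q i) 𝐏 :=
    iIndepFun_pi (X := fun _ (y : unitInterval) => if (y : ℝ) ≤ q then (1 : ℝ) else 0)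
      fun _ => (measurable_ite_le q).aemeasurable
  have := (h.indepFun hij).integral_mul_eq_mul_integral
    (measurable_hit q i).aestronglyMeasurable (measurable_hit q j).aestronglyMeasurable
  rw [integral_hit h0 h1, integral_hit h0 h1] at this
  rw [sq, ← this]
  rfl

lemma integral_sum_hit {q : ℝ} (h0 : 0 ≤ q) (h1 : q ≤ 1) (s : Finset ι) :
    ∫ x, ∑ i ∈ s, hit q i x ∂𝐏 = s.card * q := by
  rw [integral_finsetSum _ fun i _ => integrable_hit q i]
  simp [integral_hit h0 h1]

lemma integrable_sum_hit (q : ℝ) (s : Finset ι) :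
    Integrable (fun x => ∑ i ∈ s, hit q i x) 𝐏 :=
  integrable_finsetSum _ fun i _ => integrable_hit q i

lemma integrable_sum_hit_sq (q : ℝ) (s : Finset ι) :
    Integrable (fun x => (∑ i ∈ s, hit q i x) ^ 2) 𝐏 := by
  simp only [sq, Finset.sum_mul_sum]
  exact integrable_finsetSum _ fun i _ => integrable_finsetSum _ fun j _ =>
    integrable_hit_mul_hit q i j

lemma integral_sum_hit_sq_le {q : ℝ} (h0 : 0 ≤ q) (h1 : q ≤ 1) (s : Finset ι) :
    ∫ x, (∑ i ∈ s, hit q i x) ^ 2 ∂𝐏 ≤ s.card ^ 2 * q ^ 2 + s.card * q := by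
  classical
  simp only [sq (∑ i ∈ s, _), Finset.sum_mul_sum]
  rw [integral_finsetSum _ fun i _ => integrable_finsetSum _ fun j _ =>
    integrable_hit_mul_hit q i j]
  have hb : ∀ i j : ι, ∫ x, hit q i x * hit q j x ∂𝐏 ≤ q ^ 2 + if i = j then q else 0 := by
    intro i j
    split_ifs with hij
    · subst hij
      simp only [hit_mul_self, integral_hit h0 h1]
      linarith [sq_nonneg q]
    · simp [integral_hit_mul_hit h0 h1 hij]
  calc ∑ i ∈ s, ∫ x, ∑ j ∈ s, hit q i x * hit q j x ∂𝐏
      ≤ ∑ i ∈ s, ∑ j ∈ s, (q ^ 2 + if i = j then q else 0) := by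
        refine Finset.sum_le_sum fun i _ => ?_
        rw [integral_finsetSum _ fun j _ => integrable_hit_mul_hit q i j]
        exact Finset.sum_le_sum fun j _ => hb i j
    _ = s.card ^ 2 * q ^ 2 + s.card * q := by
        simp only [Finset.sum_add_distrib, Finset.sum_const, nsmul_eq_mul, Finset.sum_ite_eq,
          Finset.sum_ite_mem, Finset.inter_self]
        ring

end Moments

/-! ### One-step contraction around a blue vertex -/

lemma closedBlueCount_pos {V : Type*} [DecidableEq V] {G : SimpleGraph V} [DecidableRel G.Adj]
    {B : Finset V} {u : V} (hu : u ∈ B) : 0 < closedBlueCount G B u :=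
  Finset.card_pos.2 ⟨u, by simp [hu]⟩

section

variable (G : SimpleGraph V) [DecidableRel G.Adj]

/-- The neighbors of `u` outside `B`. -/
def whiteNeighbors (B : Finset V) (u : V) : Finset V := G.neighborFinset u \ B

variable {G}

lemma card_whiteNeighbors_add {B : Finset V} {u : V} (hu : u ∈ B) :
    (whiteNeighbors G B u).card + closedBlueCount G B u = G.degree u + 1 := by
  have h : insert u (G.neighborFinset u) =
      whiteNeighbors G B u ∪ B.filter fun w => w = u ∨ G.Adj u w := by
    ext w
    by_cases hw : w = u
    · simp [hw, hu]
    · simp only [whiteNeighbors, Finset.mem_insert, hw, Finset.mem_union, Finset.mem_sdiff,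
        SimpleGraph.mem_neighborFinset, Finset.mem_filter]
      tauto
  have hd : Disjoint (whiteNeighbors G B u) (B.filter fun w => w = u ∨ G.Adj u w) :=
    Finset.disjoint_of_subset_right (Finset.filter_subset _ _) Finset.sdiff_disjoint
  rw [closedBlueCount, ← Finset.card_union_of_disjoint hd, ← h,
    Finset.card_insert_of_notMem (by simp), SimpleGraph.card_neighborFinset_eq_degree]

/-- Only forces issued by `u` itself are counted; those of other vertices can only help. -/
lemma closedBlueCount_step_ge {B : Finset V} {u : V} (hu : u ∈ B) (x : V × V → unitInterval) :
    closedBlueCount G B u +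
      ((whiteNeighbors G B u).filter fun v => (x (u, v) : ℝ) ≤ forceProb G B u).card ≤
      closedBlueCount G (step G B x) u := by
  classical
  unfold closedBlueCount
  rw [← Finset.card_union_of_disjoint]
  · refine Finset.card_le_card fun v hv => ?_
    simp only [Finset.mem_union, Finset.mem_filter, whiteNeighbors, Finset.mem_sdiff,
      SimpleGraph.mem_neighborFinset, step, Finset.mem_univ, true_and] at hv ⊢
    rcases hv with hv | hv
    · exact ⟨Or.inl hv.1, hv.2⟩
    · exact ⟨Or.inr ⟨u, hu, hv.1.1, hv.2⟩, Or.inr hv.1.1⟩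
  · refine Finset.disjoint_left.2 fun v hv hv' => ?_
    simp only [Finset.mem_filter, whiteNeighbors, Finset.mem_sdiff] at hv hv'
    exact hv'.1.2 hv.1

/-- The ratio of white to blue vertices around a blue vertex `u` contracts by a constant factor in
expectation. -/
lemma transition_whiteRatio_le {B : Finset V} {u : V} (hu : u ∈ B) :
    transition G (fun B => ENNReal.ofReal (whiteRatio (G.degree u) (closedBlueCount G B u))) B ≤
      ENNReal.ofReal (3 / 4) *
        ENNReal.ofReal (whiteRatio (G.degree u) (closedBlueCount G B u)) := by
  set d := G.degree u
  set k := closedBlueCount G B u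
  set W := whiteNeighbors G B u
  have hk : 0 < k := closedBlueCount_pos hu
  have hwk : W.card + k = d + 1 := card_whiteNeighbors_add hu
  rw [← ENNReal.ofReal_mul (by norm_num)]
  -- Without white neighbors `k = d + 1`, so `k / d` is not a probability; but the ratio is then
  -- already zero.
  rcases Nat.eq_zero_or_pos W.card with hW0 | hWpos
  · have h0 : whiteRatio d k = 0 := by
      have : k = d + 1 := by omega
      have h : ((d : ℝ) + 1) ≠ 0 := by positivity
      rw [whiteRatio, this]; push_cast; rw [div_self h, sub_self]
    rw [h0, mul_zero, ENNReal.ofReal_zero, nonpos_iff_eq_zero, transition,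
      lintegral_eq_zero_iff (measurable_comp_step G
        (fun B => ENNReal.ofReal (whiteRatio d (closedBlueCount G B u))) B)]
    refine ae_of_all _ fun x => ENNReal.ofReal_eq_zero.2 ?_
    exact (whiteRatio_anti hk ((Nat.le_add_right _ _).trans (closedBlueCount_step_ge hu x))).trans
      h0.le
  have hq : forceProb G B u = (k : ℝ) / d := rfl
  have hq0 : 0 ≤ (k : ℝ) / d := by positivity
  have hq1 : (k : ℝ) / d ≤ 1 := by
    refine div_le_one_of_le₀ ?_ (by positivity)
    exact_mod_cast (by omega : k ≤ d)
  set s : Finset (V × V) := W.map ⟨fun v => (u, v), fun _ _ h => (Prod.ext_iff.1 h).2⟩ with hs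
  have hscard : s.card = W.card := Finset.card_map _
  set X : (V × V → unitInterval) → ℝ := fun x => ∑ i ∈ s, hit ((k : ℝ) / d) i x with hX
  have hXcard : ∀ x, X x = ((W.filter fun v => (x (u, v) : ℝ) ≤ forceProb G B u).card : ℝ) := by
    intro x
    simp only [hX, hs, Finset.sum_map]
    simp only [hit, hq, Finset.sum_boole]
    rfl
  set h : (V × V → unitInterval) → ℝ := fun x =>
    ((d : ℝ) + 1) / k * (1 - (3 * (X x / k) - X x ^ 2 / k ^ 2) / 4) - 1 with hh
  have hle : ∀ x, whiteRatio d (closedBlueCount G (step G B x) u) ≤ h x := by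
    intro x
    refine (whiteRatio_anti (by omega) (closedBlueCount_step_ge hu x)).trans ?_
    simp only [hh, hXcard]
    exact whiteRatio_add_le d k _ hk
  have hnn : ∀ x, 0 ≤ h x := by
    intro x
    have hux := subset_step G B x hu
    refine (whiteRatio_nonneg (closedBlueCount_pos hux) ?_).trans (hle x)
    rw [← card_whiteNeighbors_add hux]
    exact Nat.le_add_left _ _
  have i1 := integrable_sum_hit ((k : ℝ) / d) s
  have i2 := integrable_sum_hit_sq ((k : ℝ) / d) s
  have i3 : Integrable (fun x => 3 * (X x / k) - X x ^ 2 / k ^ 2)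
      (Measure.pi fun _ : V × V => (volume : Measure unitInterval)) :=
    ((i1.div_const _).const_mul _).sub (i2.div_const _)
  have i4 : Integrable (fun x => ((d : ℝ) + 1) / k * (1 - (3 * (X x / k) - X x ^ 2 / k ^ 2) / 4))
      (Measure.pi fun _ : V × V => (volume : Measure unitInterval)) :=
    ((integrable_const _).sub (i3.div_const _)).const_mul _
  have hint : Integrable h (Measure.pi fun _ : V × V => (volume : Measure unitInterval)) :=
    i4.sub (integrable_const _)
  calc transition G (fun B => ENNReal.ofReal (whiteRatio d (closedBlueCount G B u))) B
      ≤ ∫⁻ x, ENNReal.ofReal (h x) ∂(Measure.pi fun _ : V × V => (volume : Measure unitInterval)) :=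
        lintegral_mono fun x => ENNReal.ofReal_le_ofReal (hle x)
    _ = ENNReal.ofReal (∫ x, h x ∂(Measure.pi fun _ : V × V => (volume : Measure unitInterval))) :=
        (ofReal_integral_eq_lintegral_ofReal hint (ae_of_all _ hnn)).symm
    _ ≤ _ := by
        refine ENNReal.ofReal_le_ofReal ?_
        rw [hh, integral_sub i4 (integrable_const _), integral_const_mul,
          integral_sub (integrable_const _) (i3.div_const _), integral_div,
          integral_sub ((i1.div_const _).const_mul _) (i2.div_const _), integral_const_mul,
          integral_div, integral_div]
        simp only [integral_const, probReal_univ, smul_eq_mul, mul_one]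
        refine expected_whiteRatio_le hk hwk ?_ ?_
        · rw [integral_sum_hit hq0 hq1, hscard]
        · rw [← hscard]
          exact integral_sum_hit_sq_le hq0 hq1 s

end

/-! ### Tail bounds and expected propagation time -/

section

variable {G : SimpleGraph V} [DecidableRel G.Adj]

/-- A neighbor of a blue vertex is white after `t` steps with exponentially small probability. -/
lemma iterate_transition_notMem_le {B : Finset V} {u v : V} (hu : u ∈ B) (huv : G.Adj u v)
    {n : ℕ} (hn : G.degree u ≤ n) (t : ℕ) :
    (transition G)^[t] (fun B => if v ∈ B then 0 else 1) B ≤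
      ENNReal.ofReal (n ^ 2 * (3 / 4) ^ t) := by
  set d := G.degree u with hd
  let f : Finset V → ℝ≥0∞ := fun B => ENNReal.ofReal (whiteRatio d (closedBlueCount G B u))
  have hd0 : 0 < d := (G.degree_pos_iff_exists_adj u).2 ⟨v, huv⟩
  have hd0' : (0 : ℝ) < d := by exact_mod_cast hd0
  -- While `v` is white, the blue count is at most `d`, so the ratio is at least `1 / d`.
  have hpt : ∀ B', B ⊆ B' → (if v ∈ B' then 0 else 1) ≤ ENNReal.ofReal d * f B' := by
    intro B' hB'
    split_ifs with hv
    · exact zero_le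
    have hw : 0 < (whiteNeighbors G B' u).card :=
      Finset.card_pos.2 ⟨v, by simp [whiteNeighbors, huv, hv]⟩
    have hc := card_whiteNeighbors_add (G := G) (hB' hu)
    have hr : whiteRatio d d ≤ whiteRatio d (closedBlueCount G B' u) :=
      whiteRatio_anti (closedBlueCount_pos (hB' hu)) (by omega)
    rw [← ENNReal.ofReal_mul hd0'.le, ← ENNReal.ofReal_one]
    refine ENNReal.ofReal_le_ofReal ?_
    have e : (d : ℝ) * whiteRatio d d = 1 := by unfold whiteRatio; field_simp; ring
    rw [← e]
    gcongr
  have hf : f B ≤ ENNReal.ofReal d := by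
    refine ENNReal.ofReal_le_ofReal ?_
    refine (whiteRatio_anti one_pos (closedBlueCount_pos hu)).trans ?_
    simp [whiteRatio]
  have hit := iterate_transition_le_pow (G := G) (f := f) (c := ENNReal.ofReal (3 / 4)) (s := 1)
    (B := B) (fun B' hB' => transition_whiteRatio_le (hB' hu)) t
  rw [one_mul] at hit
  calc (transition G)^[t] (fun B => if v ∈ B then 0 else 1) B
      ≤ (transition G)^[t] (fun B => ENNReal.ofReal d * f B) B := iterate_transition_mono t hpt
    _ = ENNReal.ofReal d * (transition G)^[t] f B := iterate_transition_const_mul _ _ _ _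
    _ ≤ ENNReal.ofReal d * (ENNReal.ofReal (3 / 4) ^ t * ENNReal.ofReal d) := by
        gcongr
        exact hit.trans (by gcongr)
    _ = ENNReal.ofReal (d ^ 2 * (3 / 4) ^ t) := by
        rw [← ENNReal.ofReal_pow (by norm_num), ← ENNReal.ofReal_mul (by positivity),
          ← ENNReal.ofReal_mul (by positivity)]
        congr 1; ring
    _ ≤ _ := by gcongr

/-- The propagation time is at most `s` times the number of multiples of `s` at which some vertex
is still white. -/
lemma propTime_le_tsum {s : ℕ} (hs : 0 < s) (S : Finset V) (ω : Sample V) :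
    (propTime G S ω : ℝ≥0∞) ≤
      s * ∑' m : ℕ, if blue G S ω (s * m) = Finset.univ then 0 else 1 := by
  by_cases h : ∃ m, blue G S ω (s * m) = Finset.univ
  · have h1 : propTime G S ω ≤ ((s * Nat.find h : ℕ) : ℕ∞) :=
      iInf₂_le (f := fun t (_ : blue G S ω t = Finset.univ) => (t : ℕ∞)) _ (Nat.find_spec h)
    have h2 : (propTime G S ω : ℝ≥0∞) ≤ ((s * Nat.find h : ℕ) : ℝ≥0∞) := by
      exact_mod_cast ENat.toENNReal_le.2 h1
    refine h2.trans ?_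
    rw [Nat.cast_mul]
    gcongr
    refine le_trans (le_of_eq ?_) (ENNReal.sum_le_tsum (Finset.range (Nat.find h)))
    rw [Finset.sum_congr rfl fun m hm => if_neg (Nat.find_min h (Finset.mem_range.1 hm))]
    simp
  · have h' : ∀ m, (if blue G S ω (s * m) = Finset.univ then 0 else 1 : ℝ≥0∞) = 1 :=
      fun m => if_neg fun hm => h ⟨m, hm⟩
    simp only [h', ENNReal.tsum_const_eq_top_of_ne_zero one_ne_zero]
    rw [ENNReal.mul_top (by exact_mod_cast hs.ne')]
    exact le_top

lemma eptFrom_le_tsum {s : ℕ} (hs : 0 < s) (S : Finset V) :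
    eptFrom G S ≤
      s * ∑' m : ℕ, (transition G)^[s * m] (fun B => if B = Finset.univ then 0 else 1) S := by
  have hm : ∀ m : ℕ, Measurable fun ω : Sample V =>
      (if blue G S ω (s * m) = Finset.univ then 0 else 1 : ℝ≥0∞) := fun m =>
    (measurable_of_countable fun B : Finset V => (if B = Finset.univ then 0 else 1 : ℝ≥0∞)).comp
      (measurable_blue G S (s * m))
  calc eptFrom G S
      ≤ ∫⁻ ω, s * ∑' m : ℕ, (if blue G S ω (s * m) = Finset.univ then 0 else 1)
          ∂(sampleMeasure V) := lintegral_mono fun ω => propTime_le_tsum hs S ω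
    _ = _ := by
        rw [lintegral_const_mul _ (Measurable.tsum hm),
          lintegral_tsum fun m => (hm m).aemeasurable]
        congr 2
        ext1 m
        exact lintegral_blue G S (s * m) fun B => if B = Finset.univ then 0 else 1

end

lemma tsum_le_of_le_geometric {a : ℕ → ℝ≥0∞} (N : ℕ) (h1 : ∀ m, a m ≤ 1)
    (h2 : ∀ j, a (N + j) ≤ ENNReal.ofReal (3 / 4) ^ j) : ∑' m, a m ≤ N + 4 := by
  rw [← ENNReal.summable.sum_add_tsum_nat_add' (k := N)]
  gcongr
  · exact (Finset.sum_le_sum fun m _ => h1 m).trans (by simp)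
  · calc ∑' j, a (j + N) ≤ ∑' j, ENNReal.ofReal (3 / 4) ^ j :=
          ENNReal.tsum_le_tsum fun j => by rw [add_comm]; exact h2 j
      _ = 4 := by
          rw [ENNReal.tsum_geometric, ← ENNReal.ofReal_one, ← ENNReal.ofReal_sub _ (by norm_num),
            ← ENNReal.ofReal_inv_of_pos (by norm_num)]
          norm_num

/-! ### Distance potential on the hypercube -/

section Hypercube

variable {n : ℕ}

lemma degree_hypercube_le (x : Fin n → Bool) : (hypercube n).degree x ≤ n := by
  rw [← SimpleGraph.card_neighborFinset_eq_degree]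
  have h : (hypercube n).neighborFinset x ⊆
      Finset.univ.image fun i => Function.update x i (!x i) := by
    intro y hy
    rw [SimpleGraph.mem_neighborFinset] at hy
    have hy : hammingDist x y = 1 := hy
    obtain ⟨i, hi⟩ := Finset.card_eq_one.1 hy
    refine Finset.mem_image.2 ⟨i, Finset.mem_univ _, funext fun j => ?_⟩
    have hj := Finset.ext_iff.1 hi j
    simp only [Finset.mem_filter, Finset.mem_univ, true_and, Finset.mem_singleton] at hj
    by_cases hji : j = i
    · subst hji
      have : x j ≠ y j := hj.2 rfl
      rw [Function.update_self]
      revert this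
      cases x j <;> cases y j <;> simp
    · rw [Function.update_of_ne hji]
      exact not_not.1 fun hne => hji (hj.1 hne)
  exact (Finset.card_le_card h).trans (Finset.card_image_le.trans (by simp))

lemma exists_adj_hammingDist {x v : Fin n → Bool} (h : x ≠ v) :
    ∃ y, (hypercube n).Adj x y ∧ hammingDist x v = hammingDist y v + 1 := by
  obtain ⟨i, hi⟩ := Function.ne_iff.1 h
  refine ⟨Function.update x i (v i), ?_, ?_⟩
  · change hammingDist x _ = 1
    refine Finset.card_eq_one.2 ⟨i, Finset.ext fun j => ?_⟩
    by_cases hji : j = i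
    · subst hji; simp [hi]
    · simp [hji]
  · unfold hammingDist
    rw [← Finset.card_erase_add_one (a := i) (by simp [hi])]
    congr 2
    ext j
    by_cases hji : j = i
    · subst hji; simp
    · simp [hji]

/-- The weight of a blue vertex at distance `d` from a target vertex. -/
def distWeight (d : ℕ) : ℝ := if d = 0 then 0 else 4 ^ d

lemma distWeight_nonneg (d : ℕ) : 0 ≤ distWeight d := by
  unfold distWeight; split_ifs <;> positivity

lemma distWeight_le (d : ℕ) : distWeight d ≤ 4 ^ d := by
  unfold distWeight; split_ifs <;> simp

/-- The least weight of a blue vertex with respect to the target `v`. -/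
def distPotential (v : Fin n → Bool) (B : Finset (Fin n → Bool)) : ℝ≥0∞ :=
  ⨅ b ∈ B, ENNReal.ofReal (distWeight (hammingDist b v))

lemma distPotential_le {v b : Fin n → Bool} {B : Finset (Fin n → Bool)} (hb : b ∈ B) :
    distPotential v B ≤ ENNReal.ofReal (distWeight (hammingDist b v)) :=
  iInf₂_le b hb

lemma one_le_distPotential {v : Fin n → Bool} {B : Finset (Fin n → Bool)} (hv : v ∉ B) :
    1 ≤ distPotential v B := by
  refine le_iInf₂ fun b hb => ?_
  rw [ENNReal.one_le_ofReal, distWeight, if_neg]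
  · exact one_le_pow₀ (by norm_num)
  · exact hammingDist_ne_zero.2 fun h => hv (h ▸ hb)

/-- For any blue `b ≠ v`, let `y` be a neighbor at distance `e`, one closer to `v`. Since `b` stays
blue and `y` is white with probability at most `1/2`, the expectation is at most `4^e + 4^(e+1) / 2
= (3/4) 4^(e+1)`, apart from the zero weight at `e = 0`, which only helps. Then take the infimum
over `b`. -/
lemma iterate_transition_distPotential_le {s : ℕ} (hs : (n : ℝ) ^ 2 * (3 / 4) ^ s ≤ 1 / 2)
    (v : Fin n → Bool) (B : Finset (Fin n → Bool)) :
    (transition (hypercube n))^[s] (distPotential v) B ≤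
      ENNReal.ofReal (3 / 4) * distPotential v B := by
  rw [distPotential, ENNReal.mul_iInf_of_ne (by simp) (by simp)]
  refine le_iInf fun b => ?_
  rw [ENNReal.mul_iInf_of_ne (by simp) (by simp)]
  refine le_iInf fun hb => ?_
  rw [← ENNReal.ofReal_mul (by norm_num)]
  set d := hammingDist b v with hd
  -- Weight `0` at distance `0` matters here: the potential vanishes for good once `v` is blue.
  by_cases hbv : b = v
  · calc (transition (hypercube n))^[s] (distPotential v) B
        ≤ (transition (hypercube n))^[s] (fun _ => 0) B :=
          iterate_transition_mono s fun B' hB' => (distPotential_le (hB' hb)).trans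
            (by simp [hbv, distWeight])
      _ = 0 := iterate_transition_const s 0 B
      _ ≤ _ := zero_le
  obtain ⟨y, hadj, hy⟩ := exists_adj_hammingDist hbv
  set e := hammingDist y v with he
  calc (transition (hypercube n))^[s] (distPotential v) B
      ≤ (transition (hypercube n))^[s] (fun B' => ENNReal.ofReal (distWeight e) +
          ENNReal.ofReal (distWeight d) * (if y ∈ B' then 0 else 1)) B := by
        refine iterate_transition_mono s fun B' hB' => ?_
        split_ifs with hyB
        · simpa using distPotential_le hyB
        · rw [mul_one]
          exact (distPotential_le (hB' hb)).trans le_add_self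
    _ = ENNReal.ofReal (distWeight e) + ENNReal.ofReal (distWeight d) *
          (transition (hypercube n))^[s] (fun B' => if y ∈ B' then 0 else 1) B := by
        rw [iterate_transition_add, iterate_transition_const, iterate_transition_const_mul]
    _ ≤ ENNReal.ofReal (distWeight e) + ENNReal.ofReal (distWeight d) *
          ENNReal.ofReal (1 / 2) := by
        gcongr
        exact (iterate_transition_notMem_le hb hadj (degree_hypercube_le b) s).trans
          (ENNReal.ofReal_le_ofReal hs)
    _ ≤ _ := by
        rw [← ENNReal.ofReal_mul (distWeight_nonneg d),
          ← ENNReal.ofReal_add (distWeight_nonneg e)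
            (mul_nonneg (distWeight_nonneg d) (by norm_num))]
        refine ENNReal.ofReal_le_ofReal ?_
        have h1 := distWeight_le e
        have h2 : distWeight d = 4 * 4 ^ e := by
          rw [hd, hy, distWeight, if_neg (by omega), pow_succ, mul_comm]
        rw [h2]
        linarith

lemma eptFrom_hypercube_le {s : ℕ} (hs0 : 0 < s) (hs : (n : ℝ) ^ 2 * (3 / 4) ^ s ≤ 1 / 2)
    (x : Fin n → Bool) : eptFrom (hypercube n) {x} ≤ s * (8 * n + 4) := by
  refine (eptFrom_le_tsum hs0 {x}).trans ?_
  gcongr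
  have h1 : ∀ m, (transition (hypercube n))^[s * m]
      (fun B => if B = Finset.univ then 0 else 1) {x} ≤ 1 := fun m => by
    refine le_trans (iterate_transition_mono _ (g := fun _ => 1) fun B _ => ?_)
      (iterate_transition_const _ 1 _).le
    split_ifs <;> simp
  have h2 : ∀ m, (transition (hypercube n))^[s * m]
      (fun B => if B = Finset.univ then 0 else 1) {x} ≤
        ENNReal.ofReal (3 / 4) ^ m * 8 ^ n := fun m => by
    calc (transition (hypercube n))^[s * m] (fun B => if B = Finset.univ then 0 else 1) {x}
        ≤ (transition (hypercube n))^[s * m] (fun B => ∑ v, distPotential v B) {x} := by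
          refine iterate_transition_mono _ fun B _ => ?_
          split_ifs with hB
          · exact zero_le
          obtain ⟨v, hv⟩ : ∃ v, v ∉ B := by
            by_contra! h
            exact hB (Finset.eq_univ_iff_forall.2 h)
          exact (one_le_distPotential hv).trans
            (Finset.single_le_sum (f := fun v => distPotential v B) (fun _ _ => zero_le)
              (Finset.mem_univ v))
      _ ≤ ENNReal.ofReal (3 / 4) ^ m * ∑ v, distPotential v {x} := by
          rw [iterate_transition_sum, Finset.mul_sum]
          exact Finset.sum_le_sum fun v _ => iterate_transition_le_pow
            (fun B' _ => iterate_transition_distPotential_le hs v B') m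
      _ ≤ ENNReal.ofReal (3 / 4) ^ m * ∑ v : Fin n → Bool, 4 ^ n := by
          gcongr with v
          refine (distPotential_le (Finset.mem_singleton_self x)).trans ?_
          have h : distWeight (hammingDist x v) ≤ 4 ^ n :=
            (distWeight_le _).trans (pow_le_pow_right₀ (by norm_num)
              (hammingDist_le_card_fintype.trans (by simp)))
          refine (ENNReal.ofReal_le_ofReal h).trans ?_
          rw [ENNReal.ofReal_pow (by norm_num)]
          simp
      _ = _ := by
          simp only [Finset.sum_const, Finset.card_univ, Fintype.card_fun, Fintype.card_bool,
            Fintype.card_fin, nsmul_eq_mul, Nat.cast_pow, Nat.cast_ofNat]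
          rw [← mul_pow]
          norm_num
  -- The cutoff `8 * n` works because `8 * (3/4)^8 ≤ 1`.
  have h3 := tsum_le_of_le_geometric (8 * n) h1 fun j => by
    refine (h2 (8 * n + j)).trans ?_
    rw [pow_add, mul_right_comm, pow_mul, ← mul_pow]
    refine mul_le_of_le_one_left zero_le (pow_le_one₀ zero_le ?_)
    rw [← ENNReal.ofReal_pow (by norm_num), show (8 : ℝ≥0∞) = ENNReal.ofReal 8 by simp,
      ← ENNReal.ofReal_mul (by norm_num), ENNReal.ofReal_le_one]
    norm_num
  simpa using h3

end Hypercube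

end ProbZeroForcing

end

/-! ### Choice of constants -/

theorem theorem3 :
    ∃ C : ℝ, 0 < C ∧ ∀ n : ℕ, 2 ≤ n →
      ProbZeroForcing.ept (ProbZeroForcing.hypercube n) ≤
        ENNReal.ofReal (C * ((n : ℝ) * Real.log (n : ℝ))) := by
  -- `140 = 14 * 10`: `s ≤ 14 log n` since `log n > 1/2`, and `8n + 4 ≤ 10n` since `n ≥ 2`.
  refine ⟨140, by norm_num, fun n hn => ?_⟩
  have hn2 : (2 : ℝ) ≤ n := by exact_mod_cast hn
  have hn0 : (0 : ℝ) < n := by linarith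
  have hlog : 1 / 2 < Real.log n := by
    have := Real.log_le_log (by norm_num) hn2
    linarith [Real.log_two_gt_d9]
  -- As `3/4 ≤ exp (-1/4)`, the factor `12` gives `(3/4)^s ≤ n⁻³`, leaving `1/n ≤ 1/2`.
  set s := ⌈12 * Real.log n⌉₊
  have hs1 : 12 * Real.log n ≤ s := Nat.le_ceil _
  have hs2 : (s : ℝ) < 12 * Real.log n + 1 := Nat.ceil_lt_add_one (by linarith)
  have hs0 : 0 < s := Nat.ceil_pos.2 (by linarith)
  have hs : (n : ℝ) ^ 2 * (3 / 4) ^ s ≤ 1 / 2 := by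
    have e1 : (3 / 4 : ℝ) ≤ Real.exp (-(1 / 4)) := by
      linarith [Real.add_one_le_exp (-(1 / 4) : ℝ)]
    have e2 : (3 / 4 : ℝ) ^ s ≤ Real.exp (-(3 * Real.log n)) := by
      calc (3 / 4 : ℝ) ^ s ≤ Real.exp (-(1 / 4)) ^ s := by gcongr
        _ = Real.exp (s * -(1 / 4)) := (Real.exp_nat_mul _ _).symm
        _ ≤ _ := Real.exp_le_exp.2 (by linarith)
    have e3 : Real.exp (-(3 * Real.log n)) = ((n : ℝ) ^ 3)⁻¹ := by
      rw [Real.exp_neg, show (3 : ℝ) * Real.log n = ((3 : ℕ) : ℝ) * Real.log n by norm_num,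
        Real.exp_nat_mul, Real.exp_log hn0]
    calc (n : ℝ) ^ 2 * (3 / 4) ^ s ≤ n ^ 2 * ((n : ℝ) ^ 3)⁻¹ := by
          rw [← e3]; gcongr
      _ = 1 / (n : ℝ) := by field_simp
      _ ≤ 1 / 2 := by gcongr
  calc ProbZeroForcing.ept (ProbZeroForcing.hypercube n)
      ≤ ProbZeroForcing.eptFrom (ProbZeroForcing.hypercube n) {fun _ => false} := iInf_le _ _
    _ ≤ s * (8 * n + 4) := ProbZeroForcing.eptFrom_hypercube_le hs0 hs _
    _ = ENNReal.ofReal (s * (8 * n + 4)) := by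
        rw [ENNReal.ofReal_mul (by positivity), ENNReal.ofReal_add (by positivity) (by norm_num),
          ENNReal.ofReal_mul (by norm_num)]
        simp
    _ ≤ _ := by
        refine ENNReal.ofReal_le_ofReal ?_
        have h1 : (s : ℝ) ≤ 14 * Real.log n := by linarith
        have h2 : (8 * n + 4 : ℝ) ≤ 10 * n := by linarith
        calc (s : ℝ) * (8 * n + 4) ≤ (14 * Real.log n) * (10 * n) := by gcongr
          _ = _ := by ring
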